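/- All Hilbert spaces are complex, $\otimes$ is the Hilbert space tensor product, and inner products are linear in the first variable. \textbf{Pick kernels.} Let $K$ be a Pick kernel on a set $\Lambda$: $K$ is positive definite (i.e. $\sum_{i,j}\bar c_i c_jK(\lambda_i,\lambda_j)\ge 0$ for all finite families), $K(\mu,\lambda)\neq 0$ for all $\mu,\lambda$, and for every $\lambda_0\in\Lambda$ the function $1-\frac{K(\mu,\lambda_0)K(\lambda_0,\lambda)}{K(\mu,\lambda)K(\lambda_0,\lambda_0)}$ is a positive definite kernel. Let $\mathfrak H(K)$ be the reproducing kernel Hilbert space with kernel $K$ and kernel functions $k_\lambda=K(\cdot,\lambda)$. Fix a base point $\lambda_0$, put $\delta=k_{\lambda_0}/\|k_{\lambda_0}\|$, and let $\beta:\Lambda\to\mathcal B$ be a function into a Hilbert space $\mathcal B$ whose values span a dense subspace and such that $$K(\mu,\lambda)=\frac{\delta(\mu)\overline{\delta(\lambda)}}{1-\langle\beta(\lambda),\beta(\mu)\rangle}\qquad(\mu,\lambda\in\Lambda)$$ (such a $\beta$ exists and is unique up to a unitary). \textbf{Multipliers.} For Hilbert spaces $\mathcal F',\mathcal F$, a function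 $F:\Lambda\to\mathcal L(\mathcal F',\mathcal F)$ is a multiplier if $\xi\otimes k_\lambda\mapsto F(\lambda)^*\xi\otimes k_\lambda$ extends to a bounded operator $\mathfrak m_F^*:\mathcal F\otimes\mathfrak H(K)\to\mathcal F'\otimes\mathfrak H(K)$, and a contractive multiplier if this extension is a contraction; $\mathfrak m_F:\mathcal F'\otimes\mathfrak H(K)\to\mathcal F\otimes\mathfrak H(K)$ is its adjoint. The function $B(\lambda)\xi=\langle\xi,\beta(\lambda)\rangle$, $B(\lambda):\mathcal B\to\mathbb C$, is a contractive multiplier; write $\boldsymbol B=\mathfrak m_B:\mathcal B\otimes\mathfrak H(K)\to\mathfrak H(K)$. \textbf{Range spaces.} The range space of a bounded operator $C$ is its range with the norm $\|x\|_C=\inf\{\|y\|:Cy=x\}$. A contractively included subspace $\mathcal M$ of a Hilbert space $\mathcal H$ is a vector subspace that is a Hilbert space for a norm with $\|x\|_{\mathcal H}\le\|x\|_{\mathcal M}$ for $x\in\mathcal M$; if $J$ is its inclusion map and $\mathcal F$ is a Hilbert space, then $\mathcal F\otimes\mathcal M\subset\mathcal F\otimes\mathcal H$ denotes the range space of $I_{\mathcal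 F}\otimes J$. \textbf{Theorem.} Let $\mathcal G$ be a Hilbert space and $\mathcal M$ a contractively included subspace of $\mathfrak H(K)\otimes\mathcal G$. The following are equivalent: (i) for all Hilbert spaces $\mathcal F',\mathcal F$ and every multiplier $F:\Lambda\to\mathcal L(\mathcal F',\mathcal F)$, $(\mathfrak m_F\otimes I_{\mathcal G})(\mathcal F'\otimes\mathcal M)\subset\mathcal F\otimes\mathcal M$; moreover, if $F$ is a contractive multiplier, then $\mathfrak m_F\otimes I_{\mathcal G}$ acts contractively from $\mathcal F'\otimes\mathcal M$ to $\mathcal F\otimes\mathcal M$; (ii) $(\boldsymbol B\otimes I_{\mathcal G})(\mathcal B\otimes\mathcal M)\subset\mathcal M$, and $\boldsymbol B\otimes I_{\mathcal G}$ acts contractively from $\mathcal B\otimes\mathcal M$ to $\mathcal M$; (iii) there exist a Hilbert space $\mathcal G'$ and a contractive multiplier $G:\Lambda\to\mathcal L(\mathcal G',\mathcal G)$ such that $\mathcal M=\mathcal M_G$ with equality of norms, where $\mathcal M_G$ is the range space of $\mathfrak m_G$ (with $\mathcal G\otimes\mathfrak H(K)$ identified with $\mathfrak H(K)\otimes\mathcal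 G$). -/

import Mathlib

open scoped TensorProduct

universe u v w

namespace PickSpace

section HilbertTensor

/-- The Hilbert space tensor product `E ⊗ F`: the completion of the algebraic tensor product
for the inner product with `⟪x ⊗ y, x' ⊗ y'⟫ = ⟪x, x'⟫ * ⟪y, y'⟫`. -/
abbrev HilbertTensor (E F : Type*) [NormedAddCommGroup E] [InnerProductSpace ℂ E]
    [NormedAddCommGroup F] [InnerProductSpace ℂ F] : Type _ :=
  UniformSpace.Completion (E ⊗[ℂ] F)

infixr:70 " ⊗ₕ " => HilbertTensor

/-- The simple tensor `x ⊗ y` in the Hilbert space tensor product. -/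
noncomputable def tmul {E F : Type*} [NormedAddCommGroup E] [InnerProductSpace ℂ E]
    [NormedAddCommGroup F] [InnerProductSpace ℂ F] (x : E) (y : F) : E ⊗ₕ F :=
  ((x ⊗ₜ[ℂ] y : E ⊗[ℂ] F) : UniformSpace.Completion (E ⊗[ℂ] F))

variable {E F G E' F' : Type*}
  [NormedAddCommGroup E] [InnerProductSpace ℂ E] [NormedAddCommGroup F] [InnerProductSpace ℂ F]
  [NormedAddCommGroup G] [InnerProductSpace ℂ G]
  [NormedAddCommGroup E'] [InnerProductSpace ℂ E'] [NormedAddCommGroup F'] [InnerProductSpace ℂ F']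

/-- The operator `S ⊗ T` between Hilbert space tensor products. -/
noncomputable def tensorMap (S : E →L[ℂ] E') (T : F →L[ℂ] F') : E ⊗ₕ F →L[ℂ] E' ⊗ₕ F' :=
  (TensorProduct.mapL S T).completion

theorem tensorMap_tmul (S : E →L[ℂ] E') (T : F →L[ℂ] F') (x : E) (y : F) :
    tensorMap S T (tmul x y) = tmul (S x) (T y) := by
  simp [tensorMap, tmul]

/-- The algebraic triple tensor product inside `(E ⊗ F) ⊗ G`. -/
noncomputable def embLeft (E F G : Type*)
    [NormedAddCommGroup E] [InnerProductSpace ℂ E] [NormedAddCommGroup F] [InnerProductSpace ℂ F]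
    [NormedAddCommGroup G] [InnerProductSpace ℂ G] :
    (E ⊗[ℂ] F) ⊗[ℂ] G →ₗᵢ[ℂ] (E ⊗ₕ F) ⊗ₕ G :=
  UniformSpace.Completion.toComplₗᵢ.comp
    (TensorProduct.mapIsometry UniformSpace.Completion.toComplₗᵢ LinearIsometry.id)

/-- The algebraic triple tensor product inside `E ⊗ (F ⊗ G)`. -/
noncomputable def embRight (E F G : Type*)
    [NormedAddCommGroup E] [InnerProductSpace ℂ E] [NormedAddCommGroup F] [InnerProductSpace ℂ F]
    [NormedAddCommGroup G] [InnerProductSpace ℂ G] :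
    E ⊗[ℂ] (F ⊗[ℂ] G) →ₗᵢ[ℂ] E ⊗ₕ (F ⊗ₕ G) :=
  UniformSpace.Completion.toComplₗᵢ.comp
    (TensorProduct.mapIsometry LinearIsometry.id UniformSpace.Completion.toComplₗᵢ)

theorem span_tmul_dense {X Y : Type*} [NormedAddCommGroup X] [InnerProductSpace ℂ X]
    [NormedAddCommGroup Y] [InnerProductSpace ℂ Y] {s : Submodule ℂ (X ⊗ₕ Y)}
    (hs : IsClosed (s : Set (X ⊗ₕ Y))) (h : ∀ x y, tmul x y ∈ s) : ∀ z, z ∈ s := by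
  intro z
  induction z using UniformSpace.Completion.induction_on with
  | hp => exact hs
  | ih a =>
    induction a using TensorProduct.induction_on with
    | zero =>
      rw [UniformSpace.Completion.coe_zero]
      exact s.zero_mem
    | tmul x y => exact h x y
    | add a b ha hb =>
      rw [UniformSpace.Completion.coe_add]
      exact s.add_mem ha hb

theorem embLeft_denseRange : DenseRange (embLeft E F G) := by
  let s : Submodule ℂ ((E ⊗ₕ F) ⊗ₕ G) :=
    (LinearMap.range (embLeft E F G).toLinearMap).topologicalClosure
  have hs : IsClosed (s : Set ((E ⊗ₕ F) ⊗ₕ G)) := Submodule.isClosed_topologicalClosure _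
  have key : ∀ z, z ∈ s := by
    refine span_tmul_dense hs fun x y => ?_
    let L : (E ⊗ₕ F) →L[ℂ] (E ⊗ₕ F) ⊗ₕ G :=
      (UniformSpace.Completion.toComplL).comp ((TensorProduct.mkL ℂ (E ⊗ₕ F) G).flip y)
    have hL : ∀ x, x ∈ s.comap L.toLinearMap := by
      refine span_tmul_dense (hs.preimage L.continuous) fun a b => ?_
      refine Submodule.le_topologicalClosure _ ⟨(a ⊗ₜ[ℂ] b) ⊗ₜ[ℂ] y, rfl⟩
    exact hL x
  intro z
  exact key z

theorem embRight_denseRange : DenseRange (embRight E F G) := by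
  let s : Submodule ℂ (E ⊗ₕ (F ⊗ₕ G)) :=
    (LinearMap.range (embRight E F G).toLinearMap).topologicalClosure
  have hs : IsClosed (s : Set (E ⊗ₕ (F ⊗ₕ G))) := Submodule.isClosed_topologicalClosure _
  have key : ∀ z, z ∈ s := by
    refine span_tmul_dense hs fun x y => ?_
    let L : (F ⊗ₕ G) →L[ℂ] E ⊗ₕ (F ⊗ₕ G) :=
      (UniformSpace.Completion.toComplL).comp (TensorProduct.mkL ℂ E (F ⊗ₕ G) x)
    have hL : ∀ y, y ∈ s.comap L.toLinearMap := by
      refine span_tmul_dense (hs.preimage L.continuous) fun a b => ?_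
      refine Submodule.le_topologicalClosure _ ⟨x ⊗ₜ[ℂ] (a ⊗ₜ[ℂ] b), rfl⟩
    exact hL y
  intro z
  exact key z

/-- The canonical unitary `(E ⊗ F) ⊗ G ≃ E ⊗ (F ⊗ G)`. -/
noncomputable def tensorAssoc (E F G : Type*)
    [NormedAddCommGroup E] [InnerProductSpace ℂ E] [NormedAddCommGroup F] [InnerProductSpace ℂ F]
    [NormedAddCommGroup G] [InnerProductSpace ℂ G] :
    (E ⊗ₕ F) ⊗ₕ G ≃ₗᵢ[ℂ] E ⊗ₕ (F ⊗ₕ G) :=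
  (TensorProduct.assocIsometry ℂ E F G).toLinearEquiv.extendOfIsometry
    (embLeft E F G).toLinearMap (embRight E F G).toLinearMap
    embLeft_denseRange embRight_denseRange (fun x => by
      change ‖embRight E F G (TensorProduct.assocIsometry ℂ E F G x)‖ = ‖embLeft E F G x‖
      rw [LinearIsometry.norm_map, LinearIsometry.norm_map, LinearIsometryEquiv.norm_map])

theorem tensorAssoc_tmul (x : E) (y : F) (z : G) :
    tensorAssoc E F G (tmul (tmul x y) z) = tmul x (tmul y z) :=
  LinearEquiv.extendOfIsometry_eq (TensorProduct.assocIsometry ℂ E F G).toLinearEquiv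
    (embLeft E F G).toLinearMap (embRight E F G).toLinearMap
    embLeft_denseRange embRight_denseRange _ ((x ⊗ₜ[ℂ] y) ⊗ₜ[ℂ] z)

/-- The canonical unitary `E ⊗ F ≃ F ⊗ E`. -/
noncomputable def tensorComm (E F : Type*)
    [NormedAddCommGroup E] [InnerProductSpace ℂ E] [NormedAddCommGroup F] [InnerProductSpace ℂ F] :
    E ⊗ₕ F →L[ℂ] F ⊗ₕ E :=
  (TensorProduct.commIsometry ℂ E F).toContinuousLinearEquiv.toContinuousLinearMap.completion

theorem tensorComm_tmul (x : E) (y : F) : tensorComm E F (tmul x y) = tmul y x := by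
  simp [tensorComm, tmul]

/-- The canonical unitary `ℂ ⊗ E ≃ E`. -/
noncomputable def tensorLid (E : Type*)
    [NormedAddCommGroup E] [InnerProductSpace ℂ E] [CompleteSpace E] : ℂ ⊗ₕ E →L[ℂ] E :=
  (TensorProduct.lidIsometry ℂ E).toContinuousLinearEquiv.toContinuousLinearMap.fromCompletion

theorem tensorLid_tmul [CompleteSpace E] (c : ℂ) (x : E) : tensorLid E (tmul c x) = c • x := by
  simp [tensorLid, tmul]

end HilbertTensor

section RangeSpace

variable {X Y X₁ Y₁ X₂ Y₂ : Type*}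
  [NormedAddCommGroup X] [InnerProductSpace ℂ X] [NormedAddCommGroup Y] [InnerProductSpace ℂ Y]
  [NormedAddCommGroup X₁] [InnerProductSpace ℂ X₁] [NormedAddCommGroup Y₁] [InnerProductSpace ℂ Y₁]
  [NormedAddCommGroup X₂] [InnerProductSpace ℂ X₂] [NormedAddCommGroup Y₂] [InnerProductSpace ℂ Y₂]

/-- The norm of the range space of `C`: `‖y‖_C = inf {‖x‖ : C x = y}`, for `y` in the range
of `C`. -/
noncomputable def rangeNorm (C : X →L[ℂ] Y) (y : Y) : ℝ :=
  sInf {r : ℝ | ∃ x : X, C x = y ∧ ‖x‖ = r}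

/-- `C₁` and `C₂` have the same range space, with equality of norms. -/
def SameRangeSpace (C₁ : X₁ →L[ℂ] Y) (C₂ : X₂ →L[ℂ] Y) : Prop :=
  Set.range C₁ = Set.range C₂ ∧ ∀ y ∈ Set.range C₁, rangeNorm C₁ y = rangeNorm C₂ y

/-- `T` maps the range of `C₁` into the range of `C₂`. -/
def MapsRange (T : Y₁ →L[ℂ] Y₂) (C₁ : X₁ →L[ℂ] Y₁) (C₂ : X₂ →L[ℂ] Y₂) : Prop :=
  ∀ y ∈ Set.range C₁, T y ∈ Set.range C₂

/-- `T` acts contractively from the range space of `C₁` to the range space of `C₂`. -/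
def ContractiveOnRange (T : Y₁ →L[ℂ] Y₂) (C₁ : X₁ →L[ℂ] Y₁) (C₂ : X₂ →L[ℂ] Y₂) : Prop :=
  ∀ y ∈ Set.range C₁, rangeNorm C₂ (T y) ≤ rangeNorm C₁ y

/-- `J : X → Y` is the inclusion map of a contractively included subspace of `Y`: the vector
subspace `J X` carries the Hilbert norm transported from `X`. -/
def IsContractiveInclusion (J : X →L[ℂ] Y) : Prop :=
  Function.Injective J ∧ ∀ x, ‖J x‖ ≤ ‖x‖

end RangeSpace

section Kernels

open scoped ComplexOrder InnerProductSpace ComplexConjugate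

variable {Λ : Type*}

/-- The normalization `δ = k_{λ₀} / ‖k_{λ₀}‖` of the kernel function at the base point;
`‖k_{λ₀}‖ ^ 2 = K λ₀ λ₀`. -/
noncomputable def pickDelta (K : Λ → Λ → ℂ) (l₀ : Λ) (m : Λ) : ℂ :=
  K m l₀ / (Real.sqrt (K l₀ l₀).re : ℂ)

/-- Pick kernels: positive definite kernels without zeros such that, for every base point `l₀`,
`1 - K(m, l₀) K(l₀, l) / (K(m, l) K(l₀, l₀))` is also a positive definite kernel. -/
structure IsPickKernel (K : Λ → Λ → ℂ) : Prop where
  posSemidef : (Matrix.of K).PosSemidef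
  ne_zero : ∀ m l, K m l ≠ 0
  pick : ∀ l₀ : Λ,
    (Matrix.of fun m l : Λ => 1 - K m l₀ * K l₀ l / (K m l * K l₀ l₀)).PosSemidef

variable {B : Type*} [NormedAddCommGroup B] [InnerProductSpace ℂ B]

/-- `K(m, l) = δ(m) conj(δ(l)) / (1 - ⟨β(l), β(m)⟩)`, where the vectors `β(l)` span a dense
subspace. The inner product `⟨x, y⟩`, linear in `x`, is `⟪y, x⟫_ℂ`. -/
structure IsPickRealization (K : Λ → Λ → ℂ) (l₀ : Λ) (β : Λ → B) : Prop where
  kernel_eq : ∀ m l, K m l =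
    pickDelta K l₀ m * conj (pickDelta K l₀ l) / (1 - ⟪β m, β l⟫_ℂ)
  minimal : (Submodule.span ℂ (Set.range β)).topologicalClosure = ⊤

/-- `B(l) : B → ℂ`, `B(l) ξ = ⟨ξ, β(l)⟩`. -/
noncomputable def pickRow (β : Λ → B) (l : Λ) : B →L[ℂ] ℂ := innerSL ℂ (β l)

end Kernels

section Multipliers

variable {Λ : Type*} (H : Type*) [NormedAddCommGroup H] [InnerProductSpace ℂ H] [CompleteSpace H]
  [RKHS ℂ H Λ ℂ]

/-- The kernel function `k_l` of a scalar reproducing kernel Hilbert space: `⟨f, k_l⟩ = f(l)`. -/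
noncomputable def kernelFun (l : Λ) : H := RKHS.kerFun H l (1 : ℂ)

/-- The scalar kernel `K(m, l) = k_l(m)`. -/
noncomputable def scalarKernel (m l : Λ) : ℂ := kernelFun H l m

variable {E E' : Type*}
  [NormedAddCommGroup E] [InnerProductSpace ℂ E] [CompleteSpace E]
  [NormedAddCommGroup E'] [InnerProductSpace ℂ E'] [CompleteSpace E']

/-- `S` is a bounded extension of `ξ ⊗ k_l ↦ F(l)* ξ ⊗ k_l`. -/
def IsMultiplierAdjoint (F : Λ → E' →L[ℂ] E) (S : E ⊗ₕ H →L[ℂ] E' ⊗ₕ H) : Prop :=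
  ∀ (ξ : E) (l : Λ), S (tmul ξ (kernelFun H l)) = tmul ((F l).adjoint ξ) (kernelFun H l)

def IsMultiplier (F : Λ → E' →L[ℂ] E) : Prop :=
  ∃ S : E ⊗ₕ H →L[ℂ] E' ⊗ₕ H, IsMultiplierAdjoint H F S

def IsContractiveMultiplier (F : Λ → E' →L[ℂ] E) : Prop :=
  ∃ S : E ⊗ₕ H →L[ℂ] E' ⊗ₕ H, IsMultiplierAdjoint H F S ∧ ∀ x, ‖S x‖ ≤ ‖x‖

open Classical in
/-- The operator `𝔪_F : E' ⊗ H → E ⊗ H` of a multiplier `F`, defined through its adjoint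
(and `0` if `F` is not a multiplier). -/
noncomputable def multOp (F : Λ → E' →L[ℂ] E) : E' ⊗ₕ H →L[ℂ] E ⊗ₕ H :=
  if h : IsMultiplier H F then (Classical.choose h).adjoint else 0

variable (G : Type*) [NormedAddCommGroup G] [InnerProductSpace ℂ G]

/-- `𝔪_F ⊗ I_G : E' ⊗ (H ⊗ G) → E ⊗ (H ⊗ G)`. -/
noncomputable def multOpTensor (F : Λ → E' →L[ℂ] E) :
    E' ⊗ₕ (H ⊗ₕ G) →L[ℂ] E ⊗ₕ (H ⊗ₕ G) :=
  (tensorAssoc E H G).toContinuousLinearEquiv.toContinuousLinearMap ∘L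
    tensorMap (multOp H F) (ContinuousLinearMap.id ℂ G) ∘L
    (tensorAssoc E' H G).symm.toContinuousLinearEquiv.toContinuousLinearMap

variable {B : Type*} [NormedAddCommGroup B] [InnerProductSpace ℂ B] [CompleteSpace B]

/-- The operator `𝐁 : B ⊗ H → H` of the multiplier `l ↦ B(l)`, with `ℂ ⊗ H` identified
with `H`. -/
noncomputable def pickOp (β : Λ → B) : B ⊗ₕ H →L[ℂ] H :=
  tensorLid H ∘L multOp H (pickRow β)

/-- `𝐁 ⊗ I_G : B ⊗ (H ⊗ G) → H ⊗ G`. -/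
noncomputable def pickOpTensor (β : Λ → B) : B ⊗ₕ (H ⊗ₕ G) →L[ℂ] H ⊗ₕ G :=
  tensorMap (pickOp H β) (ContinuousLinearMap.id ℂ G) ∘L
    (tensorAssoc B H G).symm.toContinuousLinearEquiv.toContinuousLinearMap

end Multipliers

section Existence

open scoped ComplexOrder InnerProductSpace ComplexConjugate

theorem inner_tmul {E F : Type*} [NormedAddCommGroup E] [InnerProductSpace ℂ E]
    [NormedAddCommGroup F] [InnerProductSpace ℂ F] (x x' : E) (y y' : F) :
    ⟪tmul x y, tmul x' y'⟫_ℂ = ⟪x, x'⟫_ℂ * ⟪y, y'⟫_ℂ := by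
  simp [tmul, UniformSpace.Completion.inner_coe]

theorem inner_kernelFun {Λ : Type*} (H : Type*) [NormedAddCommGroup H] [InnerProductSpace ℂ H]
    [CompleteSpace H] [RKHS ℂ H Λ ℂ] (m : Λ) (f : H) : ⟪kernelFun H m, f⟫_ℂ = f m := by
  simp [kernelFun]

theorem tmul_smul_left {E F : Type*} [NormedAddCommGroup E] [InnerProductSpace ℂ E]
    [NormedAddCommGroup F] [InnerProductSpace ℂ F] (c : ℂ) (x : E) (y : F) :
    tmul (c • x) y = c • tmul x y := by
  simp only [tmul, ← TensorProduct.smul_tmul', UniformSpace.Completion.coe_smul]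

/-- The function `l ↦ B(l)` is a contractive multiplier. -/
theorem isContractiveMultiplier_pickRow {Λ : Type*} {K : Λ → Λ → ℂ} (hK : IsPickKernel K)
    (H : Type*) [NormedAddCommGroup H] [InnerProductSpace ℂ H] [CompleteSpace H]
    [RKHS ℂ H Λ ℂ] (hH : scalarKernel H = K) (l₀ : Λ)
    {B : Type*} [NormedAddCommGroup B] [InnerProductSpace ℂ B] [CompleteSpace B]
    (β : Λ → B) (hβ : IsPickRealization K l₀ β) : IsContractiveMultiplier H (pickRow β) := by
  have hrep : ∀ m l, ⟪kernelFun H m, kernelFun H l⟫_ℂ = K m l := fun m l => by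
    rw [inner_kernelFun, ← hH]; rfl
  have hδ : ∀ m l, K m l * (1 - ⟪β m, β l⟫_ℂ) = pickDelta K l₀ m * conj (pickDelta K l₀ l) := by
    intro m l
    have h := hβ.kernel_eq m l
    have h0 : 1 - ⟪β m, β l⟫_ℂ ≠ 0 := by
      intro h0
      rw [h0, div_zero] at h
      exact hK.ne_zero m l h
    rw [h]
    field_simp
  let e : (Λ →₀ ℂ) →ₗ[ℂ] ℂ ⊗ₕ H :=
    Finsupp.linearCombination ℂ fun l => tmul (1 : ℂ) (kernelFun H l)
  let f : (Λ →₀ ℂ) →ₗ[ℂ] B ⊗ₕ H :=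
    Finsupp.linearCombination ℂ fun l => tmul (β l) (kernelFun H l)
  have hdense : DenseRange e := by
    let s : Submodule ℂ (ℂ ⊗ₕ H) := (LinearMap.range e).topologicalClosure
    have hs : IsClosed (s : Set (ℂ ⊗ₕ H)) := Submodule.isClosed_topologicalClosure _
    have key : ∀ z, z ∈ s := by
      refine span_tmul_dense hs fun c y => ?_
      let L : H →L[ℂ] ℂ ⊗ₕ H :=
        (UniformSpace.Completion.toComplL).comp (TensorProduct.mkL ℂ ℂ H c)
      have hcl : IsClosed ((s.comap L.toLinearMap : Submodule ℂ H) : Set H) :=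
        hs.preimage L.continuous
      have h1 : Submodule.span ℂ {RKHS.kerFun H x v | (x : Λ) (v : ℂ)} ≤ s.comap L.toLinearMap := by
        rw [Submodule.span_le]
        rintro _ ⟨x, v, rfl⟩
        refine Submodule.le_topologicalClosure _ ⟨Finsupp.single x (v * c), ?_⟩
        have hv : RKHS.kerFun H x v = v • kernelFun H x := by
          rw [kernelFun, ← map_smul]; simp
        change e _ = tmul c (RKHS.kerFun H x v)
        simp only [e, Finsupp.linearCombination_single, hv]
        rw [← tmul_smul_left]
        simp only [tmul, smul_eq_mul, mul_one]
        rw [TensorProduct.tmul_smul, TensorProduct.smul_tmul', smul_eq_mul]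
      have h2 := Submodule.topologicalClosure_minimal _ h1 hcl
      rw [RKHS.kerFun_dense] at h2
      exact h2 (Submodule.mem_top (x := y))
    exact fun z => key z
  have hnorm : ∀ c, ‖f c‖ ≤ 1 * ‖e c‖ := by
    intro c
    rw [one_mul]
    refine (sq_le_sq₀ (norm_nonneg _) (norm_nonneg _)).mp ?_
    have key : ⟪e c, e c⟫_ℂ - ⟪f c, f c⟫_ℂ =
        (Complex.normSq (c.sum fun l z => z * conj (pickDelta K l₀ l)) : ℂ) := by
      simp only [e, f, Finsupp.linearCombination_apply, Finsupp.sum_inner, Finsupp.inner_sum,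
        inner_smul_left, inner_smul_right, inner_tmul, hrep]
      rw [Complex.normSq_eq_conj_mul_self]
      simp only [Finsupp.sum, map_sum, map_mul, Complex.conj_conj, Finset.mul_sum,
        ← Finset.sum_sub_distrib, Finset.sum_mul]
      refine Finset.sum_congr rfl fun m _ => Finset.sum_congr rfl fun l _ => ?_
      have h11 : ⟪(1 : ℂ), 1⟫_ℂ = 1 := by simp
      rw [h11]
      linear_combination (c m * conj (c l)) * hδ l m
    have hre := congrArg Complex.re key
    rw [Complex.sub_re, Complex.ofReal_re] at hre
    have hn := Complex.normSq_nonneg (c.sum fun l z => z * conj (pickDelta K l₀ l))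
    have he : ‖e c‖ ^ 2 = (⟪e c, e c⟫_ℂ).re := norm_sq_eq_re_inner (𝕜 := ℂ) _
    have hf : ‖f c‖ ^ 2 = (⟪f c, f c⟫_ℂ).re := norm_sq_eq_re_inner (𝕜 := ℂ) _
    linarith
  refine ⟨f.extendOfNorm e, fun ξ l => ?_, fun x => ?_⟩
  · have h := LinearMap.extendOfNorm_eq hdense ⟨1, hnorm⟩ (Finsupp.single l ξ)
    simp only [e, f, Finsupp.linearCombination_single, ← tmul_smul_left] at h
    have hadj : (pickRow β l).adjoint ξ = ξ • β l := by
      refine ext_inner_right ℂ fun b => ?_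
      rw [ContinuousLinearMap.adjoint_inner_left]
      simp [pickRow, inner_smul_left, mul_comm]
    rw [hadj]
    simpa using h
  · simpa using LinearMap.norm_extendOfNorm_apply_le hdense 1 hnorm x

/-- The function `β` exists for every Pick kernel and every base point. -/
theorem exists_pickRealization {Λ : Type u} {K : Λ → Λ → ℂ} (hK : IsPickKernel K) (l₀ : Λ) :
    ∃ (B : Type u) (_ : NormedAddCommGroup B) (_ : InnerProductSpace ℂ B) (_ : CompleteSpace B)
      (β : Λ → B), IsPickRealization K l₀ β := by
  let L : Λ → Λ → ℂ := fun m l => 1 - K m l₀ * K l₀ l / (K m l * K l₀ l₀)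
  have hL : (Matrix.of L).PosSemidef := hK.pick l₀
  let N : Matrix Λ Λ (ℂ →L[ℂ] ℂ) := Matrix.of fun m l => L m l • ContinuousLinearMap.id ℂ ℂ
  have hconj : ∀ m l, conj (L l m) = L m l := fun m l => hL.isHermitian.apply m l
  have hN : N.PosSemidef := by
    have htfae := (RKHS.posSemidef_tfae (K := N)).out 0 2
    refine htfae.mpr ⟨?_, fun vv => ?_⟩
    · refine Matrix.ext fun m l => ?_
      rw [Matrix.conjTranspose_apply]
      change star (L l m • (1 : ℂ →L[ℂ] ℂ)) = L m l • (1 : ℂ →L[ℂ] ℂ)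
      rw [star_smul, star_one, ← hconj m l]
      rfl
    · have h := (Complex.le_def.mp (hL.2 vv)).1
      refine h.trans_eq ?_
      change Complex.re _ = Complex.re _
      congr 1
      refine Finset.sum_congr rfl fun m _ => Finset.sum_congr rfl fun l _ => ?_
      simp [N, hconj]
      ring
  have : Fact N.PosSemidef := ⟨hN⟩
  refine ⟨RKHS.OfKernel N, inferInstance, inferInstance, inferInstance,
    fun l => kernelFun (RKHS.OfKernel N) l, ⟨fun m l => ?_, ?_⟩⟩
  · have h1 : ⟪kernelFun (RKHS.OfKernel N) m, kernelFun (RKHS.OfKernel N) l⟫_ℂ = L m l := by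
      rw [inner_kernelFun, kernelFun, RKHS.kerFun_apply, RKHS.OfKernel.kernel_ofKernel]
      simp [N]
    rw [h1]
    have h00 := hK.ne_zero l₀ l₀
    have hc : ∀ m l, conj (K l m) = K m l := fun m l => hK.posSemidef.isHermitian.apply m l
    have hpos : 0 ≤ K l₀ l₀ := hK.posSemidef.diag_nonneg
    have hre : K l₀ l₀ = ((K l₀ l₀).re : ℂ) :=
      (Complex.conj_eq_iff_re.mp (hc l₀ l₀)).symm
    have hs : (Real.sqrt (K l₀ l₀).re : ℂ) * (Real.sqrt (K l₀ l₀).re : ℂ) = K l₀ l₀ := by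
      rw [← Complex.ofReal_mul, Real.mul_self_sqrt (Complex.le_def.mp hpos).1, ← hre]
    have hd : pickDelta K l₀ m * conj (pickDelta K l₀ l) = K m l₀ * K l₀ l / K l₀ l₀ := by
      rw [pickDelta, pickDelta, map_div₀, Complex.conj_ofReal, hc, div_mul_div_comm, hs]
    have := hK.ne_zero m l
    have := hK.ne_zero m l₀
    have := hK.ne_zero l₀ l
    rw [hd]
    simp only [L]
    field_simp
    simp
  · rw [eq_top_iff, ← RKHS.kerFun_dense (H := RKHS.OfKernel N)]
    refine Submodule.topologicalClosure_mono ?_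
    rw [Submodule.span_le]
    rintro _ ⟨x, v, rfl⟩
    have hv : RKHS.kerFun (RKHS.OfKernel N) x v = v • kernelFun (RKHS.OfKernel N) x := by
      rw [kernelFun, ← map_smul]; simp
    rw [hv]
    exact Submodule.smul_mem _ _ (Submodule.subset_span ⟨x, rfl⟩)

end Existence

end PickSpace

open PickSpace

/-! By Douglas' lemma, a map acts contractively between two range spaces exactly when it lifts to a
contraction between the source spaces, and two operators into the same space have the same range
space exactly when each is a contraction followed by the other
(`mapsRange_and_contractiveOnRange_iff`, `sameRangeSpace_iff`). All three conditions thus become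
operator identities, and these are checked on adjoints, where a multiplier acts on tensors with a
kernel function `k_l` pointwise, through `F(l)*`.

(iii) ⇒ (i): `𝔪_F` and `𝔪_Φ` act on different coefficient spaces, hence commute, so `𝔪_F ⊗ I` on
`G'` lifts `𝔪_F ⊗ I` on `G` through `𝔪_Φ`. (i) ⇒ (ii): `𝐁` is itself the operator of a contractive
multiplier.

(ii) ⇒ (iii) is the core. If the contraction `T` lifts `𝐁 ⊗ I`, then `T* J* (k_l ⊗ g) = β(l) ⊗ J*
(k_l ⊗ g)`. The positive operator `D = J(1 - TT*)J*` therefore has the entries of `JJ*` on the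
vectors `k_l ⊗ g`, multiplied by `1 - ⟪β m, β l⟫ = δ(m) conj(δ(l)) / K(m, l)`. Factoring `D = R*R`
and dividing by `δ` writes `JJ*` as `K` times a Gram kernel. This says `JJ* = 𝔪_F 𝔪_F*` up to the
swap of factors, and Douglas' lemma gives equality of range spaces. -/

namespace PickSpace

open scoped InnerProductSpace ComplexConjugate ComplexOrder
open ContinuousLinearMap (adjoint)

/-! ### Range spaces and lifted operators -/

section RangeSpaces

variable {X Y X₁ Y₁ X₂ Y₂ : Type*}
  [NormedAddCommGroup X] [InnerProductSpace ℂ X] [NormedAddCommGroup Y] [InnerProductSpace ℂ Y]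
  [NormedAddCommGroup X₁] [InnerProductSpace ℂ X₁] [NormedAddCommGroup Y₁] [InnerProductSpace ℂ Y₁]
  [NormedAddCommGroup X₂] [InnerProductSpace ℂ X₂] [NormedAddCommGroup Y₂] [InnerProductSpace ℂ Y₂]

theorem rangeNorm_le (C : X →L[ℂ] Y) (x : X) : rangeNorm C (C x) ≤ ‖x‖ :=
  csInf_le ⟨0, by rintro _ ⟨x, -, rfl⟩; exact norm_nonneg x⟩ ⟨x, rfl, rfl⟩

/-- The lift `Z` carries each preimage of `y` to a preimage of `T y`, no longer if `Z` is a
contraction. The inclusion of ranges needs no norm bound, which serves the noncontractive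
multipliers in (i). -/
theorem mapsRange_contractiveOnRange_of_factor {T : Y₁ →L[ℂ] Y₂} {C₁ : X₁ →L[ℂ] Y₁}
    {C₂ : X₂ →L[ℂ] Y₂} {Z : X₁ →L[ℂ] X₂} (h : T ∘L C₁ = C₂ ∘L Z) :
    MapsRange T C₁ C₂ ∧ (‖Z‖ ≤ 1 → ContractiveOnRange T C₁ C₂) := by
  have h' : ∀ x, T (C₁ x) = C₂ (Z x) := fun x => congrArg (fun A => A x) h
  constructor
  · rintro _ ⟨x, rfl⟩
    exact ⟨Z x, (h' x).symm⟩
  · rintro hZ _ ⟨x, rfl⟩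
    refine le_csInf ⟨_, x, rfl, rfl⟩ ?_
    rintro _ ⟨x', hx', rfl⟩
    rw [← hx', h']
    exact (rangeNorm_le C₂ _).trans ((Z.le_of_opNorm_le hZ x').trans_eq (one_mul _))

end RangeSpaces

/-! ### Douglas' lemma and positive square roots -/

section Douglas

variable {X Y X₁ Y₁ X₂ Y₂ : Type*}
  [NormedAddCommGroup X] [InnerProductSpace ℂ X] [CompleteSpace X]
  [NormedAddCommGroup Y] [InnerProductSpace ℂ Y] [CompleteSpace Y]
  [NormedAddCommGroup X₁] [InnerProductSpace ℂ X₁] [CompleteSpace X₁]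
  [NormedAddCommGroup Y₁] [InnerProductSpace ℂ Y₁]
  [NormedAddCommGroup X₂] [InnerProductSpace ℂ X₂] [CompleteSpace X₂]
  [NormedAddCommGroup Y₂] [InnerProductSpace ℂ Y₂] [CompleteSpace Y₂]

/-- Douglas' factorization lemma, for a contractive factor. -/
theorem exists_contraction_factor (C₁ : X₁ →L[ℂ] Y) (C₂ : X₂ →L[ℂ] Y)
    (h : ∀ y, ‖adjoint C₁ y‖ ≤ ‖adjoint C₂ y‖) :
    ∃ Z : X₁ →L[ℂ] X₂, ‖Z‖ ≤ 1 ∧ C₁ = C₂ ∘L Z := by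
  -- The factor is the adjoint of the map `W` that sends `C₂* y` to `C₁* y`: by `h` this is well
  -- defined and contractive, so it extends to the closure `R` of the range of `C₂*`, and by zero to
  -- the orthogonal complement.
  let R : Submodule ℂ X₂ := (LinearMap.range (adjoint C₂).toLinearMap).topologicalClosure
  have hR : IsClosed (R : Set X₂) := Submodule.isClosed_topologicalClosure _
  have : CompleteSpace R := hR.completeSpace_coe
  let e : Y →ₗ[ℂ] R := (adjoint C₂).toLinearMap.codRestrict R fun y =>
    Submodule.le_topologicalClosure _ ⟨y, rfl⟩
  have he : DenseRange e := by
    rintro ⟨x, hx⟩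
    rw [closure_subtype]
    have h1 : ((↑) '' Set.range e : Set X₂) =
        (LinearMap.range (adjoint C₂).toLinearMap : Set X₂) := by
      ext z
      simp [e]
    rw [h1]
    exact hx
  have hnorm : ∀ y, ‖(adjoint C₁).toLinearMap y‖ ≤ 1 * ‖e y‖ := fun y => by
    rw [one_mul]
    exact h y
  let W : X₂ →L[ℂ] X₁ := (adjoint C₁).toLinearMap.extendOfNorm e ∘L R.orthogonalProjectionOnto
  have hW : ‖W‖ ≤ 1 := by
    refine (ContinuousLinearMap.opNorm_comp_le _ _).trans ?_
    exact mul_le_one₀ (LinearMap.opNorm_extendOfNorm_le he zero_le_one hnorm) (norm_nonneg _)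
      (Submodule.orthogonalProjectionOnto_norm_le R)
  refine ⟨adjoint W, by rwa [LinearIsometryEquiv.norm_map], ?_⟩
  rw [← ContinuousLinearMap.adjoint_adjoint (C₂ ∘L adjoint W), ContinuousLinearMap.adjoint_comp,
    ContinuousLinearMap.adjoint_adjoint]
  rw [← ContinuousLinearMap.adjoint_adjoint C₁]
  congr 1
  ext y
  have h2 : R.orthogonalProjectionOnto (adjoint C₂ y) = e y :=
    Submodule.orthogonalProjectionOnto_mem_subspace_eq_self (e y)
  change (adjoint C₁) y = (adjoint C₁).toLinearMap.extendOfNorm e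
    (R.orthogonalProjectionOnto (adjoint C₂ y))
  rw [h2, LinearMap.extendOfNorm_eq he ⟨1, hnorm⟩]
  rfl

/-- An operator maps one range space contractively into another if and only if it lifts to a
contraction. -/
theorem mapsRange_and_contractiveOnRange_iff (T : Y₁ →L[ℂ] Y₂) (C₁ : X₁ →L[ℂ] Y₁)
    (C₂ : X₂ →L[ℂ] Y₂) :
    MapsRange T C₁ C₂ ∧ ContractiveOnRange T C₁ C₂ ↔
      ∃ Z : X₁ →L[ℂ] X₂, ‖Z‖ ≤ 1 ∧ T ∘L C₁ = C₂ ∘L Z := by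
  refine ⟨fun ⟨h1, h2⟩ => ?_, fun ⟨Z, hZ, h⟩ =>
    ⟨(mapsRange_contractiveOnRange_of_factor h).1,
      (mapsRange_contractiveOnRange_of_factor h).2 hZ⟩⟩
  refine exists_contraction_factor _ _ fun y => ?_
  set a := adjoint (T ∘L C₁) y with ha
  -- `T C₁ a` has a preimage `z` under `C₂` of norm below `‖a‖ + ε`, and `‖a‖² = ⟪T C₁ a, y⟫ = ⟪z,
  -- C₂* y⟫`. The `ε` avoids showing that the infimum is attained.
  have key : ∀ ε > 0, ‖a‖ * ‖a‖ ≤ (‖a‖ + ε) * ‖adjoint C₂ y‖ := by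
    intro ε hε
    have hlt : rangeNorm C₂ (T (C₁ a)) < ‖a‖ + ε :=
      ((h2 _ ⟨a, rfl⟩).trans (rangeNorm_le C₁ a)).trans_lt (lt_add_of_pos_right _ hε)
    obtain ⟨z₀, hz₀⟩ := h1 _ ⟨a, rfl⟩
    obtain ⟨_, ⟨z, hz, rfl⟩, hzlt⟩ := exists_lt_of_csInf_lt
      (s := {r : ℝ | ∃ x : X₂, C₂ x = T (C₁ a) ∧ ‖x‖ = r}) ⟨_, z₀, hz₀, rfl⟩ hlt
    have h3 : ⟪a, a⟫_ℂ = ⟪z, adjoint C₂ y⟫_ℂ := by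
      conv_lhs => rw [ha, ContinuousLinearMap.adjoint_inner_right]
      rw [ContinuousLinearMap.adjoint_inner_right, hz]
      rfl
    calc ‖a‖ * ‖a‖ = ‖⟪a, a⟫_ℂ‖ := by simp [inner_self_eq_norm_sq_to_K, sq]
      _ = ‖⟪z, adjoint C₂ y⟫_ℂ‖ := by rw [h3]
      _ ≤ ‖z‖ * ‖adjoint C₂ y‖ := norm_inner_le_norm _ _
      _ ≤ _ := by gcongr
  have h4 : ‖a‖ * ‖a‖ ≤ ‖a‖ * ‖adjoint C₂ y‖ := by
    have ht : Filter.Tendsto (fun ε : ℝ => (‖a‖ + ε) * ‖adjoint C₂ y‖)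
        (nhdsWithin 0 (Set.Ioi 0)) (nhds ((‖a‖ + 0) * ‖adjoint C₂ y‖)) :=
      ((continuous_const.add continuous_id).mul continuous_const).continuousWithinAt
    rw [add_zero] at ht
    refine ge_of_tendsto ht ?_
    filter_upwards [self_mem_nhdsWithin] with ε hε using key ε hε
  rcases (norm_nonneg a).eq_or_lt with h0 | h0
  · rw [← h0]; exact norm_nonneg _
  · exact le_of_mul_le_mul_left h4 h0

/-- Two range spaces coincide with their norms when the identity acts contractively in both
directions. -/
theorem sameRangeSpace_iff (C₁ : X₁ →L[ℂ] Y) (C₂ : X₂ →L[ℂ] Y) :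
    SameRangeSpace C₁ C₂ ↔ (∃ Z : X₁ →L[ℂ] X₂, ‖Z‖ ≤ 1 ∧ C₁ = C₂ ∘L Z) ∧
      ∃ Z : X₂ →L[ℂ] X₁, ‖Z‖ ≤ 1 ∧ C₂ = C₁ ∘L Z := by
  have h12 := mapsRange_and_contractiveOnRange_iff (ContinuousLinearMap.id ℂ Y) C₁ C₂
  have h21 := mapsRange_and_contractiveOnRange_iff (ContinuousLinearMap.id ℂ Y) C₂ C₁
  rw [ContinuousLinearMap.id_comp] at h12 h21
  rw [← h12, ← h21]
  constructor
  · rintro ⟨h1, h2⟩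
    refine ⟨⟨fun y hy => h1 ▸ hy, fun y hy => (h2 y hy).ge⟩,
      fun y hy => h1 ▸ hy, fun y hy => (h2 y (h1 ▸ hy)).le⟩
  · rintro ⟨⟨h1, h2⟩, h3, h4⟩
    exact ⟨Set.Subset.antisymm h1 h3, fun y hy => le_antisymm (h4 y (h1 y hy)) (h2 y hy)⟩

/-- Turns the sesquilinear form of a positive operator into a Gram form; `R` is the positive square
root. -/
theorem exists_sqrt_of_isPositive {D : X →L[ℂ] X} (hD : D.IsPositive) :
    ∃ R : X →L[ℂ] X, ∀ x y, ⟪R x, R y⟫_ℂ = ⟪x, D y⟫_ℂ := by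
  have h0 : 0 ≤ D := (ContinuousLinearMap.nonneg_iff_isPositive D).mpr hD
  have hs : (CFC.sqrt D).IsPositive :=
    (ContinuousLinearMap.nonneg_iff_isPositive _).mp (CFC.sqrt_nonneg D)
  refine ⟨CFC.sqrt D, fun x y => ?_⟩
  have hsq : CFC.sqrt D * CFC.sqrt D = D := CFC.sqrt_mul_sqrt_self D h0
  have hy : CFC.sqrt D (CFC.sqrt D y) = D y := congrArg (fun A : X →L[ℂ] X => A y) hsq
  rw [← hy]
  exact hs.isSymmetric x (CFC.sqrt D y)

end Douglas

/-! ### Hilbert tensor products: norms, adjoints, extensionality on simple tensors -/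

section Tensor

variable {E F G E' F' F'' : Type*}
  [NormedAddCommGroup E] [InnerProductSpace ℂ E] [NormedAddCommGroup F] [InnerProductSpace ℂ F]
  [NormedAddCommGroup G] [InnerProductSpace ℂ G]
  [NormedAddCommGroup E'] [InnerProductSpace ℂ E'] [NormedAddCommGroup F'] [InnerProductSpace ℂ F']
  [NormedAddCommGroup F''] [InnerProductSpace ℂ F'']

/-- `x ↦ x ⊗ y`. -/
noncomputable def tmulRight (E : Type*) [NormedAddCommGroup E] [InnerProductSpace ℂ E] (y : F) :
    E →L[ℂ] E ⊗ₕ F :=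
  UniformSpace.Completion.toComplL.comp ((TensorProduct.mkL ℂ E F).flip y)

/-- `y ↦ x ⊗ y`. -/
noncomputable def tmulLeft (F : Type*) [NormedAddCommGroup F] [InnerProductSpace ℂ F] (x : E) :
    F →L[ℂ] E ⊗ₕ F :=
  UniformSpace.Completion.toComplL.comp (TensorProduct.mkL ℂ E F x)

theorem tmulLeft_apply (x : E) (y : F) : tmulLeft F x y = tmul x y := rfl

theorem continuousLinearMap_ext_tmul {S T : E ⊗ₕ F →L[ℂ] G}
    (h : ∀ x y, S (tmul x y) = T (tmul x y)) : S = T := by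
  ext z
  exact span_tmul_dense (s := LinearMap.eqLocus S.toLinearMap T.toLinearMap)
    (isClosed_eq S.continuous T.continuous) h z

theorem norm_completion_le {X Y : Type*} [NormedAddCommGroup X] [NormedSpace ℂ X]
    [NormedAddCommGroup Y] [NormedSpace ℂ Y] {T : X →L[ℂ] Y} {C : ℝ} (hC : 0 ≤ C)
    (h : ‖T‖ ≤ C) : ‖T.completion‖ ≤ C := by
  refine ContinuousLinearMap.opNorm_le_bound _ hC fun z => ?_
  induction z using UniformSpace.Completion.induction_on with
  | hp => exact isClosed_le (by fun_prop) (by fun_prop)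
  | ih a =>
    have h1 : T.completion (a : UniformSpace.Completion X) = (T a : UniformSpace.Completion Y) := by
      simp
    rw [h1, UniformSpace.Completion.norm_coe, UniformSpace.Completion.norm_coe]
    exact T.le_of_opNorm_le h a

theorem norm_tensorMap_le (S : E →L[ℂ] E') (T : F →L[ℂ] F') : ‖tensorMap S T‖ ≤ ‖S‖ * ‖T‖ :=
  norm_completion_le (by positivity) (TensorProduct.norm_mapL_le S T)

theorem norm_tensorMap_le_one {S : E →L[ℂ] E'} {T : F →L[ℂ] F'} (hS : ‖S‖ ≤ 1) (hT : ‖T‖ ≤ 1) :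
    ‖tensorMap S T‖ ≤ 1 :=
  (norm_tensorMap_le S T).trans (mul_le_one₀ hS (norm_nonneg _) hT)

theorem norm_tensorComm_le (E F : Type*) [NormedAddCommGroup E] [InnerProductSpace ℂ E]
    [NormedAddCommGroup F] [InnerProductSpace ℂ F] : ‖tensorComm E F‖ ≤ 1 := by
  refine norm_completion_le zero_le_one
    (ContinuousLinearMap.opNorm_le_bound _ zero_le_one fun x => ?_)
  rw [one_mul]
  exact ((TensorProduct.commIsometry ℂ E F).norm_map x).le

theorem norm_tensorLid_le [CompleteSpace E] : ‖tensorLid E‖ ≤ 1 := by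
  refine ContinuousLinearMap.opNorm_le_bound _ zero_le_one fun z => ?_
  rw [one_mul]
  induction z using UniformSpace.Completion.induction_on with
  | hp => exact isClosed_le (by fun_prop) (by fun_prop)
  | ih a =>
    rw [tensorLid, ContinuousLinearMap.fromCompletion_apply_coe, UniformSpace.Completion.norm_coe]
    exact ((TensorProduct.lidIsometry ℂ E).norm_map a).le

theorem norm_linearIsometryEquiv_le (e : E ≃ₗᵢ[ℂ] F) :
    ‖e.toContinuousLinearEquiv.toContinuousLinearMap‖ ≤ 1 :=
  ContinuousLinearMap.opNorm_le_bound _ zero_le_one fun x => by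
    rw [one_mul]; exact (e.norm_map x).le

theorem tensorMap_id_comp (S : F →L[ℂ] F') (T : F' →L[ℂ] F'') :
    tensorMap (ContinuousLinearMap.id ℂ E) (T ∘L S) =
      tensorMap (ContinuousLinearMap.id ℂ E) T ∘L tensorMap (ContinuousLinearMap.id ℂ E) S :=
  continuousLinearMap_ext_tmul fun x y => by simp [tensorMap_tmul]

theorem tensorAssoc_symm_tmul (x : E) (y : F) (z : G) :
    (tensorAssoc E F G).symm (tmul x (tmul y z)) = tmul (tmul x y) z := by
  rw [← tensorAssoc_tmul, LinearIsometryEquiv.symm_apply_apply]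

theorem tensorComm_comp_self (E F : Type*) [NormedAddCommGroup E] [InnerProductSpace ℂ E]
    [NormedAddCommGroup F] [InnerProductSpace ℂ F] :
    tensorComm F E ∘L tensorComm E F = ContinuousLinearMap.id ℂ _ :=
  continuousLinearMap_ext_tmul fun x y => by simp [tensorComm_tmul]

theorem eq_of_inner_tmul {u v : E ⊗ₕ F}
    (h : ∀ x y, ⟪tmul x y, u⟫_ℂ = ⟪tmul x y, v⟫_ℂ) : u = v := by
  have h1 : innerSL ℂ u = innerSL ℂ v := continuousLinearMap_ext_tmul fun x y => by
    rw [innerSL_apply_apply, innerSL_apply_apply, ← inner_conj_symm, h, inner_conj_symm]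
  exact ext_inner_right ℂ fun z => congrArg (fun T => T z) h1

theorem adjoint_tensorMap [CompleteSpace E] [CompleteSpace F] [CompleteSpace E'] [CompleteSpace F']
    (S : E →L[ℂ] E') (T : F →L[ℂ] F') :
    adjoint (tensorMap S T) = tensorMap (adjoint S) (adjoint T) :=
  continuousLinearMap_ext_tmul fun x y => eq_of_inner_tmul fun x' y' => by
    rw [ContinuousLinearMap.adjoint_inner_right, tensorMap_tmul, tensorMap_tmul, inner_tmul,
      inner_tmul, ContinuousLinearMap.adjoint_inner_right, ContinuousLinearMap.adjoint_inner_right]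

theorem adjoint_tensorComm (E F : Type*) [NormedAddCommGroup E] [InnerProductSpace ℂ E]
    [NormedAddCommGroup F] [InnerProductSpace ℂ F] :
    adjoint (tensorComm E F) = tensorComm F E :=
  continuousLinearMap_ext_tmul fun x y => eq_of_inner_tmul fun x' y' => by
    rw [ContinuousLinearMap.adjoint_inner_right, tensorComm_tmul, tensorComm_tmul, inner_tmul,
      inner_tmul, mul_comm]

end Tensor

/-! ### Multiplication operators and their adjoints on kernel functions -/

section Multiplier

variable {Λ : Type*} (H : Type*) [NormedAddCommGroup H] [InnerProductSpace ℂ H] [CompleteSpace H]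
  [RKHS ℂ H Λ ℂ]

theorem kernelFun_span_dense {s : Submodule ℂ H} (hs : IsClosed (s : Set H))
    (h : ∀ l : Λ, kernelFun H l ∈ s) (z : H) : z ∈ s := by
  have h1 : Submodule.span ℂ {RKHS.kerFun H x v | (x : Λ) (v : ℂ)} ≤ s := by
    rw [Submodule.span_le]
    rintro _ ⟨x, v, rfl⟩
    have hv : RKHS.kerFun H x v = v • kernelFun H x := by
      rw [kernelFun, ← map_smul]; simp
    rw [hv]
    exact s.smul_mem _ (h x)
  have h2 := Submodule.topologicalClosure_minimal _ h1 hs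
  rw [RKHS.kerFun_dense] at h2
  exact h2 (Submodule.mem_top (x := z))

variable {E E' G : Type*}
  [NormedAddCommGroup E] [InnerProductSpace ℂ E] [NormedAddCommGroup E'] [InnerProductSpace ℂ E']
  [NormedAddCommGroup G] [InnerProductSpace ℂ G]

theorem tmul_kernelFun_span_dense {s : Submodule ℂ (E ⊗ₕ H)}
    (hs : IsClosed (s : Set (E ⊗ₕ H))) (h : ∀ x (l : Λ), tmul x (kernelFun H l) ∈ s) :
    ∀ z, z ∈ s :=
  span_tmul_dense hs fun x y =>
    kernelFun_span_dense H (s := s.comap (tmulLeft H x).toLinearMap)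
      (hs.preimage (tmulLeft H x).continuous) (h x) y

theorem kernelFun_tmul_span_dense {s : Submodule ℂ (H ⊗ₕ G)}
    (hs : IsClosed (s : Set (H ⊗ₕ G))) (h : ∀ (l : Λ) g, tmul (kernelFun H l) g ∈ s) :
    ∀ z, z ∈ s :=
  span_tmul_dense hs fun x y =>
    kernelFun_span_dense H (s := s.comap (tmulRight H y).toLinearMap)
      (hs.preimage (tmulRight H y).continuous) (fun l => h l y) x

variable {H}

theorem ext_tmul_kernelFun {S T : E ⊗ₕ H →L[ℂ] E'}
    (h : ∀ x (l : Λ), S (tmul x (kernelFun H l)) = T (tmul x (kernelFun H l))) : S = T := by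
  ext z
  exact tmul_kernelFun_span_dense H (s := LinearMap.eqLocus S.toLinearMap T.toLinearMap)
    (isClosed_eq S.continuous T.continuous) h z

theorem ext_tmul_kernelFun_tmul {S T : E ⊗ₕ (H ⊗ₕ G) →L[ℂ] E'}
    (h : ∀ x (l : Λ) g, S (tmul x (tmul (kernelFun H l) g)) = T (tmul x (tmul (kernelFun H l) g))) :
    S = T := by
  refine continuousLinearMap_ext_tmul fun x y => ?_
  exact kernelFun_tmul_span_dense H
    (s := LinearMap.eqLocus (S ∘L tmulLeft _ x).toLinearMap (T ∘L tmulLeft _ x).toLinearMap)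
    (isClosed_eq (S ∘L tmulLeft _ x).continuous (T ∘L tmulLeft _ x).continuous) (h x) y

variable [CompleteSpace E] [CompleteSpace E']

/-- The choice made in `multOp` is harmless: bounded extensions agree, since the tensors `ξ ⊗ k_l`
span a dense subspace. -/
theorem multOp_eq {F : Λ → E' →L[ℂ] E} {S : E ⊗ₕ H →L[ℂ] E' ⊗ₕ H} (hS : IsMultiplierAdjoint H F S) :
    multOp H F = adjoint S := by
  have h : IsMultiplier H F := ⟨S, hS⟩
  rw [multOp, dif_pos h]
  congr 1
  exact ext_tmul_kernelFun fun ξ l => (Classical.choose_spec h ξ l).trans (hS ξ l).symm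

theorem IsContractiveMultiplier.isMultiplier {F : Λ → E' →L[ℂ] E}
    (hF : IsContractiveMultiplier H F) : IsMultiplier H F :=
  hF.imp fun _ h => h.1

theorem IsMultiplier.adjoint_multOp_tmul {F : Λ → E' →L[ℂ] E} (hF : IsMultiplier H F) (ξ : E)
    (l : Λ) : adjoint (multOp H F) (tmul ξ (kernelFun H l)) =
      tmul (adjoint (F l) ξ) (kernelFun H l) := by
  obtain ⟨S, hS⟩ := hF
  rw [multOp_eq hS, ContinuousLinearMap.adjoint_adjoint, hS]

theorem IsContractiveMultiplier.norm_multOp_le {F : Λ → E' →L[ℂ] E}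
    (hF : IsContractiveMultiplier H F) : ‖multOp H F‖ ≤ 1 := by
  obtain ⟨S, hS, hn⟩ := hF
  rw [multOp_eq hS, LinearIsometryEquiv.norm_map]
  exact ContinuousLinearMap.opNorm_le_bound _ zero_le_one fun x => (hn x).trans_eq (one_mul _).symm

theorem adjoint_toContinuousLinearMap {X Y : Type*} [NormedAddCommGroup X] [InnerProductSpace ℂ X]
    [CompleteSpace X] [NormedAddCommGroup Y] [InnerProductSpace ℂ Y] [CompleteSpace Y]
    (e : X ≃ₗᵢ[ℂ] Y) (y : Y) :
    adjoint e.toContinuousLinearEquiv.toContinuousLinearMap y = e.symm y :=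
  ext_inner_left ℂ fun x => by
    rw [ContinuousLinearMap.adjoint_inner_right, ← e.inner_map_map x, e.apply_symm_apply]
    rfl

theorem IsContractiveMultiplier.norm_multOpTensor_le {F : Λ → E' →L[ℂ] E}
    (hF : IsContractiveMultiplier H F) : ‖multOpTensor H G F‖ ≤ 1 := by
  refine (ContinuousLinearMap.opNorm_comp_le _ _).trans
    (mul_le_one₀ (norm_linearIsometryEquiv_le _) (norm_nonneg _) ?_)
  exact (ContinuousLinearMap.opNorm_comp_le _ _).trans
    (mul_le_one₀ (norm_tensorMap_le_one hF.norm_multOp_le ContinuousLinearMap.norm_id_le)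
      (norm_nonneg _) (norm_linearIsometryEquiv_le _))

variable [CompleteSpace G]

theorem IsMultiplier.adjoint_multOpTensor_tmul {F : Λ → E' →L[ℂ] E} (hF : IsMultiplier H F) (ξ : E)
    (l : Λ) (g : G) : adjoint (multOpTensor H G F) (tmul ξ (tmul (kernelFun H l) g)) =
      tmul (adjoint (F l) ξ) (tmul (kernelFun H l) g) := by
  rw [multOpTensor, ContinuousLinearMap.adjoint_comp, ContinuousLinearMap.adjoint_comp,
    ContinuousLinearMap.comp_apply, ContinuousLinearMap.comp_apply, adjoint_toContinuousLinearMap,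
    adjoint_toContinuousLinearMap, tensorAssoc_symm_tmul, adjoint_tensorMap, tensorMap_tmul,
    hF.adjoint_multOp_tmul, LinearIsometryEquiv.symm_symm, tensorAssoc_tmul,
    ContinuousLinearMap.adjoint_id]
  rfl

theorem adjoint_tensorLid_apply (x : H) : adjoint (tensorLid H) x = tmul 1 x :=
  eq_of_inner_tmul fun c y => by
    rw [ContinuousLinearMap.adjoint_inner_right, tensorLid_tmul, inner_tmul, inner_smul_left]
    simp

variable {B : Type*} [NormedAddCommGroup B] [InnerProductSpace ℂ B] [CompleteSpace B]

theorem adjoint_pickRow_one (β : Λ → B) (l : Λ) : adjoint (pickRow β l) 1 = β l :=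
  ext_inner_right ℂ fun b => by
    rw [ContinuousLinearMap.adjoint_inner_left]
    simp [pickRow]

/-- The relation through which the factor `⟪β m, β l⟫` enters the Gram computation for `D`. -/
theorem adjoint_pickOpTensor_tmul {β : Λ → B} (hβ : IsMultiplier H (pickRow β)) (l : Λ) (g : G) :
    adjoint (pickOpTensor H G β) (tmul (kernelFun H l) g) =
      tmul (β l) (tmul (kernelFun H l) g) := by
  rw [pickOpTensor, ContinuousLinearMap.adjoint_comp, ContinuousLinearMap.comp_apply,
    adjoint_toContinuousLinearMap, LinearIsometryEquiv.symm_symm, adjoint_tensorMap, tensorMap_tmul,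
    pickOp, ContinuousLinearMap.adjoint_comp, ContinuousLinearMap.comp_apply,
    adjoint_tensorLid_apply, hβ.adjoint_multOp_tmul, adjoint_pickRow_one,
    ContinuousLinearMap.adjoint_id]
  exact tensorAssoc_tmul _ _ _

end Multiplier

/-! ### From a multiplier to invariance: (iii) ⇒ (i) -/

section Main

variable {Λ : Type*} {H : Type*} [NormedAddCommGroup H] [InnerProductSpace ℂ H] [CompleteSpace H]
  [RKHS ℂ H Λ ℂ]
  {E E' G G' M B : Type*}
  [NormedAddCommGroup E] [InnerProductSpace ℂ E] [CompleteSpace E]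
  [NormedAddCommGroup E'] [InnerProductSpace ℂ E'] [CompleteSpace E']
  [NormedAddCommGroup G] [InnerProductSpace ℂ G] [CompleteSpace G]
  [NormedAddCommGroup G'] [InnerProductSpace ℂ G'] [CompleteSpace G']
  [NormedAddCommGroup M] [InnerProductSpace ℂ M] [CompleteSpace M]
  [NormedAddCommGroup B] [InnerProductSpace ℂ B] [CompleteSpace B]

/-- Multiplication operators acting on different tensor factors commute. -/
theorem multOpTensor_comp_tensorMap_multOp {F : Λ → E' →L[ℂ] E} (hF : IsMultiplier H F)
    {Φ : Λ → G' →L[ℂ] G} (hΦ : IsMultiplier H Φ) :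
    multOpTensor H G F ∘L
        tensorMap (ContinuousLinearMap.id ℂ E') (tensorComm G H ∘L multOp H Φ) =
      tensorMap (ContinuousLinearMap.id ℂ E) (tensorComm G H ∘L multOp H Φ) ∘L
        (tensorMap (ContinuousLinearMap.id ℂ E) (tensorComm H G') ∘L multOpTensor H G' F ∘L
          tensorMap (ContinuousLinearMap.id ℂ E') (tensorComm G' H)) := by
  refine (ContinuousLinearMap.adjoint (𝕜 := ℂ)).injective ?_
  -- Both adjoints send `x ⊗ (k_l ⊗ g)` to `F(l)* x ⊗ (Φ(l)* g ⊗ k_l)`.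
  refine ext_tmul_kernelFun_tmul (H := H) fun x l g => ?_
  simp only [ContinuousLinearMap.adjoint_comp, ContinuousLinearMap.comp_apply, adjoint_tensorMap,
    adjoint_tensorComm, ContinuousLinearMap.adjoint_id, hF.adjoint_multOpTensor_tmul,
    hΦ.adjoint_multOp_tmul, tensorMap_tmul, tensorComm_tmul, ContinuousLinearMap.id_apply]

/-- With `C` the swapped `𝔪_Φ`, write `J = C Z` and `C = J Z'` with contractions. The lift of `𝔪_F`
through `C` then becomes one through `J` after composing with `Z` and `Z'`, which does not increase
its norm. -/
theorem exists_lift_multOpTensor {J : M →L[ℂ] H ⊗ₕ G} {Φ : Λ → G' →L[ℂ] G}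
    (hΦ : IsMultiplier H Φ) (hJ : SameRangeSpace J (tensorComm G H ∘L multOp H Φ))
    {F : Λ → E' →L[ℂ] E} (hF : IsMultiplier H F) :
    ∃ T : E' ⊗ₕ M →L[ℂ] E ⊗ₕ M, ‖T‖ ≤ ‖multOpTensor H G' F‖ ∧
      multOpTensor H G F ∘L tensorMap (ContinuousLinearMap.id ℂ E') J =
        tensorMap (ContinuousLinearMap.id ℂ E) J ∘L T := by
  obtain ⟨⟨Z, hZ, hJZ⟩, Z', hZ', hCZ'⟩ := (sameRangeSpace_iff _ _).mp hJ
  set C := tensorComm G H ∘L multOp H Φ with hC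
  refine ⟨tensorMap (ContinuousLinearMap.id ℂ E) (Z' ∘L tensorComm H G') ∘L
    multOpTensor H G' F ∘L tensorMap (ContinuousLinearMap.id ℂ E') (tensorComm G' H ∘L Z), ?_, ?_⟩
  · have h1 : ‖Z' ∘L tensorComm H G'‖ ≤ 1 := (ContinuousLinearMap.opNorm_comp_le _ _).trans
      (mul_le_one₀ hZ' (norm_nonneg _) (norm_tensorComm_le _ _))
    have h2 : ‖tensorComm G' H ∘L Z‖ ≤ 1 := (ContinuousLinearMap.opNorm_comp_le _ _).trans
      (mul_le_one₀ (norm_tensorComm_le _ _) (norm_nonneg _) hZ)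
    have h3 := norm_tensorMap_le_one (S := ContinuousLinearMap.id ℂ E)
      ContinuousLinearMap.norm_id_le h1
    have h4 := norm_tensorMap_le_one (S := ContinuousLinearMap.id ℂ E')
      ContinuousLinearMap.norm_id_le h2
    refine (ContinuousLinearMap.opNorm_comp_le _ _).trans
      ((mul_le_of_le_one_left (norm_nonneg _) h3).trans ?_)
    exact (ContinuousLinearMap.opNorm_comp_le _ _).trans (mul_le_of_le_one_right (norm_nonneg _) h4)
  · have h := multOpTensor_comp_tensorMap_multOp (G := G) hF hΦ
    rw [← hC] at h
    calc multOpTensor H G F ∘L tensorMap (ContinuousLinearMap.id ℂ E') J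
        = (multOpTensor H G F ∘L tensorMap (ContinuousLinearMap.id ℂ E') C) ∘L
            tensorMap (ContinuousLinearMap.id ℂ E') Z := by
          conv_lhs => rw [hJZ, tensorMap_id_comp]
          rfl
      _ = tensorMap (ContinuousLinearMap.id ℂ E) C ∘L
          (tensorMap (ContinuousLinearMap.id ℂ E) (tensorComm H G') ∘L multOpTensor H G' F ∘L
            tensorMap (ContinuousLinearMap.id ℂ E') (tensorComm G' H)) ∘L
            tensorMap (ContinuousLinearMap.id ℂ E') Z := by
          rw [h]; rfl
      _ = _ := by
          conv_lhs => rw [hCZ', tensorMap_id_comp]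
          rw [tensorMap_id_comp Z, tensorMap_id_comp _ Z']
          rfl

/-! ### From invariance under `𝐁` to a multiplier: (ii) ⇒ (iii) -/

/-- If the Gram matrix of the vectors `A(l) g`, multiplied by the kernel, is the Gram matrix of the
vectors `J† (k_l ⊗ g)`, then `J` has the range space of the multiplier `l ↦ A(l)†`. -/
theorem exists_multiplier_of_gram {J : M →L[ℂ] H ⊗ₕ G} (hJ : ‖J‖ ≤ 1) (A : Λ → G →L[ℂ] G')
    (hA : ∀ m l g' g, ⟪A m g', A l g⟫_ℂ * ⟪kernelFun H m, kernelFun H l⟫_ℂ =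
      ⟪adjoint J (tmul (kernelFun H m) g'), adjoint J (tmul (kernelFun H l) g)⟫_ℂ) :
    IsContractiveMultiplier H (fun l => adjoint (A l)) ∧
      SameRangeSpace J (tensorComm G H ∘L multOp H fun l => adjoint (A l)) := by
  let e : (G × Λ →₀ ℂ) →ₗ[ℂ] G ⊗ₕ H :=
    Finsupp.linearCombination ℂ fun p => tmul p.1 (kernelFun H p.2)
  let f : (G × Λ →₀ ℂ) →ₗ[ℂ] G' ⊗ₕ H :=
    Finsupp.linearCombination ℂ fun p => tmul (A p.2 p.1) (kernelFun H p.2)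
  have hdense : DenseRange e := fun z =>
    tmul_kernelFun_span_dense H (s := (LinearMap.range e).topologicalClosure)
      (Submodule.isClosed_topologicalClosure _)
      (fun g l => Submodule.le_topologicalClosure _ ⟨Finsupp.single (g, l) 1, by simp [e]⟩) z
  -- After expansion into double sums, `hA` matches the two quadratic forms term by term. Since `J*`
  -- and the swap are contractive, this also makes `e c ↦ f c` a contraction.
  have hgram : ∀ c, ‖f c‖ = ‖adjoint J (tensorComm G H (e c))‖ := by
    intro c
    have key : ⟪f c, f c⟫_ℂ =
        ⟪adjoint J (tensorComm G H (e c)), adjoint J (tensorComm G H (e c))⟫_ℂ := by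
      simp only [e, f, Finsupp.linearCombination_apply, map_finsuppSum, map_smul, tensorComm_tmul,
        Finsupp.sum_inner, Finsupp.inner_sum, inner_smul_left, inner_smul_right, inner_tmul, hA]
    rw [← sq_eq_sq₀ (norm_nonneg _) (norm_nonneg _), norm_sq_eq_re_inner (𝕜 := ℂ),
      norm_sq_eq_re_inner (𝕜 := ℂ), key]
  have hJ' : ‖adjoint J‖ ≤ 1 := by rwa [LinearIsometryEquiv.norm_map]
  have hnorm : ∀ c, ‖f c‖ ≤ 1 * ‖e c‖ := fun c => by
    rw [hgram]
    refine (ContinuousLinearMap.le_of_opNorm_le _ hJ' _).trans ?_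
    rw [one_mul]
    exact ContinuousLinearMap.le_of_opNorm_le _ (norm_tensorComm_le _ _) _
  let S : G ⊗ₕ H →L[ℂ] G' ⊗ₕ H := f.extendOfNorm e
  have hSe : ∀ c, S (e c) = f c := LinearMap.extendOfNorm_eq hdense ⟨1, hnorm⟩
  have hS : IsMultiplierAdjoint H (fun l => adjoint (A l)) S := fun g l => by
    have h := hSe (Finsupp.single (g, l) 1)
    simpa [e, f] using h
  have hSn : ∀ z, ‖S z‖ = ‖adjoint J (tensorComm G H z)‖ := fun z => by
    refine hdense.induction_on z ?_ fun c => ?_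
    · exact isClosed_eq (by fun_prop) (by fun_prop)
    · rw [hSe, hgram]
  -- Equal norms of the two adjoints at every vector allow Douglas' lemma in both directions.
  have hadj : ∀ y, ‖adjoint (tensorComm G H ∘L multOp H fun l => adjoint (A l)) y‖ =
      ‖adjoint J y‖ := fun y => by
    have h1 : tensorComm G H (tensorComm H G y) = y :=
      congrArg (fun T => T y) (tensorComm_comp_self H G)
    rw [multOp_eq hS, ContinuousLinearMap.adjoint_comp, ContinuousLinearMap.adjoint_adjoint,
      adjoint_tensorComm, ContinuousLinearMap.comp_apply, hSn, h1]
  refine ⟨⟨S, hS, fun x => ?_⟩, (sameRangeSpace_iff _ _).mpr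
    ⟨exists_contraction_factor _ _ fun y => (hadj y).ge,
      exists_contraction_factor _ _ fun y => (hadj y).le⟩⟩
  simpa using LinearMap.norm_extendOfNorm_apply_le hdense 1 hnorm x

theorem pickDelta_ne_zero {K : Λ → Λ → ℂ} (hK : IsPickKernel K) (l₀ m : Λ) :
    pickDelta K l₀ m ≠ 0 := by
  have hpos : 0 ≤ K l₀ l₀ := hK.posSemidef.diag_nonneg
  have hre : 0 < (K l₀ l₀).re := by
    refine (Complex.le_def.mp hpos).1.lt_of_ne fun h => hK.ne_zero l₀ l₀ ?_
    exact Complex.ext h.symm (Complex.le_def.mp hpos).2.symm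
  exact div_ne_zero (hK.ne_zero m l₀)
    (Complex.ofReal_ne_zero.mpr (Real.sqrt_pos.mpr hre).ne')

/-- The defect operator `D = J(1 - TT*)J*` is positive because `T` is a contraction; its square
root, applied to `k_l ⊗ g` and divided by `conj(δ(l))`, gives the adjoint values of the multiplier.
-/
theorem exists_multiplier_of_pickOpTensor_lift {K : Λ → Λ → ℂ} (hK : IsPickKernel K)
    (hH : scalarKernel H = K) (l₀ : Λ) {β : Λ → B} (hβ : IsPickRealization K l₀ β)
    {J : M →L[ℂ] H ⊗ₕ G} (hJ : ‖J‖ ≤ 1) {T : B ⊗ₕ M →L[ℂ] M} (hT : ‖T‖ ≤ 1)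
    (hTJ : pickOpTensor H G β ∘L tensorMap (ContinuousLinearMap.id ℂ B) J = J ∘L T) :
    ∃ F : Λ → (H ⊗ₕ G) →L[ℂ] G, IsContractiveMultiplier H F ∧
      SameRangeSpace J (tensorComm G H ∘L multOp H F) := by
  have hB : IsMultiplier H (pickRow β) :=
    (isContractiveMultiplier_pickRow hK H hH l₀ β hβ).isMultiplier
  have hT' : ‖adjoint T‖ ≤ 1 := by rwa [LinearIsometryEquiv.norm_map]
  let D : H ⊗ₕ G →L[ℂ] H ⊗ₕ G := J ∘L adjoint J - J ∘L T ∘L adjoint T ∘L adjoint J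
  have hDinner : ∀ x y, ⟪x, D y⟫_ℂ = ⟪adjoint J x, adjoint J y⟫_ℂ -
      ⟪adjoint T (adjoint J x), adjoint T (adjoint J y)⟫_ℂ := fun x y => by
    simp only [D, sub_apply, ContinuousLinearMap.comp_apply, inner_sub_right,
      ContinuousLinearMap.adjoint_inner_left]
  have hD : D.IsPositive := by
    rw [ContinuousLinearMap.isPositive_def']
    refine ⟨?_, fun x => ?_⟩
    · rw [ContinuousLinearMap.isSelfAdjoint_iff_isSymmetric]
      intro x y
      change ⟪D x, y⟫_ℂ = ⟪x, D y⟫_ℂ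
      rw [← inner_conj_symm, hDinner, hDinner, map_sub, inner_conj_symm, inner_conj_symm]
    · rw [ContinuousLinearMap.reApplyInnerSelf_apply, inner_re_symm, hDinner, map_sub,
        ← norm_sq_eq_re_inner, ← norm_sq_eq_re_inner, sub_nonneg]
      have h := ContinuousLinearMap.le_of_opNorm_le _ hT' (adjoint J x)
      rw [one_mul] at h
      gcongr
  obtain ⟨R, hR⟩ := exists_sqrt_of_isPositive hD
  -- Adjoint of the lifting identity `hTJ`, evaluated at `k_l ⊗ g`.
  have hTk : ∀ l g, adjoint T (adjoint J (tmul (kernelFun H l) g)) =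
      tmul (β l) (adjoint J (tmul (kernelFun H l) g)) := fun l g => by
    rw [← ContinuousLinearMap.comp_apply, ← ContinuousLinearMap.adjoint_comp, ← hTJ,
      ContinuousLinearMap.adjoint_comp, ContinuousLinearMap.comp_apply,
      adjoint_pickOpTensor_tmul hB, adjoint_tensorMap, tensorMap_tmul,
      ContinuousLinearMap.adjoint_id]
    rfl
  refine ⟨_, exists_multiplier_of_gram hJ
    (fun l => (conj (pickDelta K l₀ l))⁻¹ • (R ∘L tmulLeft G (kernelFun H l))) fun m l g' g => ?_⟩
  have hm := pickDelta_ne_zero hK l₀ m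
  have hl : conj (pickDelta K l₀ l) ≠ 0 :=
    (map_ne_zero (starRingEnd ℂ)).mpr (pickDelta_ne_zero hK l₀ l)
  have hKml : ⟪kernelFun H m, kernelFun H l⟫_ℂ = K m l := by
    rw [inner_kernelFun, ← hH]; rfl
  have hker := hβ.kernel_eq m l
  have h0 : 1 - ⟪β m, β l⟫_ℂ ≠ 0 := fun h0 => hK.ne_zero m l (by rw [hker, h0, div_zero])
  simp only [smul_apply, ContinuousLinearMap.comp_apply, tmulLeft_apply,
    inner_smul_left, inner_smul_right, hR, hDinner, hTk, inner_tmul, hKml]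
  -- The factor `1 - ⟪β m, β l⟫` coming from `D` cancels the denominator of `K m l`, and the scalars
  -- in `A` cancel its numerator.
  rw [hker, map_inv₀, Complex.conj_conj]
  field_simp

/-! ### Specialization to the row multiplier: (i) ⇒ (ii) -/

/-- Condition (i) quantifies over Hilbert spaces in one universe, which need not contain `ℂ`. The
row multiplier is therefore given values in an isometric copy `U` of `ℂ`, and `U ⊗ M` is identified
with `M` afterwards. -/
theorem pickOpTensor_lift_of_linearIsometryEquiv {U : Type*} [NormedAddCommGroup U] [InnerProductSpace ℂ U]
    [CompleteSpace U] (ι : ℂ ≃ₗᵢ[ℂ] U) {β : Λ → B}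
    (hβ : IsContractiveMultiplier H (pickRow β)) {J : M →L[ℂ] H ⊗ₕ G}
    (h : ∀ F : Λ → B →L[ℂ] U, IsContractiveMultiplier H F →
      ∃ T : B ⊗ₕ M →L[ℂ] U ⊗ₕ M, ‖T‖ ≤ 1 ∧
        multOpTensor H G F ∘L tensorMap (ContinuousLinearMap.id ℂ B) J =
          tensorMap (ContinuousLinearMap.id ℂ U) J ∘L T) :
    ∃ T : B ⊗ₕ M →L[ℂ] M, ‖T‖ ≤ 1 ∧
      pickOpTensor H G β ∘L tensorMap (ContinuousLinearMap.id ℂ B) J = J ∘L T := by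
  let i : ℂ →L[ℂ] U := ι.toContinuousLinearEquiv.toContinuousLinearMap
  let i' : U →L[ℂ] ℂ := ι.symm.toContinuousLinearEquiv.toContinuousLinearMap
  have hi' : ‖i'‖ ≤ 1 := norm_linearIsometryEquiv_le ι.symm
  have hadj : adjoint i = i' := by
    ext y
    exact adjoint_toContinuousLinearMap ι y
  have hadj' : adjoint i' = i := by rw [← hadj, ContinuousLinearMap.adjoint_adjoint]
  have hii : ∀ c, i' (i c) = c := ι.symm_apply_apply
  have hF : IsContractiveMultiplier H fun l => i ∘L pickRow β l := by
    obtain ⟨S, hS, hn⟩ := hβ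
    refine ⟨S ∘L tensorMap i' (ContinuousLinearMap.id ℂ H), fun ξ l => ?_, fun x => ?_⟩
    · rw [ContinuousLinearMap.comp_apply, tensorMap_tmul, ContinuousLinearMap.id_apply, hS,
        ContinuousLinearMap.adjoint_comp, hadj]
      rfl
    · refine (hn _).trans ?_
      simpa using ContinuousLinearMap.le_of_opNorm_le _
        (norm_tensorMap_le_one hi' (ContinuousLinearMap.norm_id_le (𝕜 := ℂ) (E := H))) x
  obtain ⟨T, hT, hTJ⟩ := h _ hF
  refine ⟨tensorLid M ∘L tensorMap i' (ContinuousLinearMap.id ℂ M) ∘L T, ?_, ?_⟩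
  · refine (ContinuousLinearMap.opNorm_comp_le _ _).trans
      (mul_le_one₀ norm_tensorLid_le (norm_nonneg _) ?_)
    exact (ContinuousLinearMap.opNorm_comp_le _ _).trans
      (mul_le_one₀ (norm_tensorMap_le_one hi' ContinuousLinearMap.norm_id_le) (norm_nonneg _) hT)
  -- Both adjoints send `k_l ⊗ g` to `β(l) ⊗ (k_l ⊗ g)`.
  · have h1 : pickOpTensor H G β = tensorLid (H ⊗ₕ G) ∘L
        tensorMap i' (ContinuousLinearMap.id ℂ (H ⊗ₕ G)) ∘L
          multOpTensor H G fun l => i ∘L pickRow β l := by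
      refine (ContinuousLinearMap.adjoint (𝕜 := ℂ)).injective ?_
      ext z
      refine kernelFun_tmul_span_dense H (s := LinearMap.eqLocus
        (adjoint (pickOpTensor H G β)).toLinearMap (adjoint (tensorLid (H ⊗ₕ G) ∘L
        tensorMap i' (ContinuousLinearMap.id ℂ (H ⊗ₕ G)) ∘L
          multOpTensor H G fun l => i ∘L pickRow β l)).toLinearMap)
        (isClosed_eq (ContinuousLinearMap.continuous _) (ContinuousLinearMap.continuous _))
        (fun l g => ?_) z
      change adjoint (pickOpTensor H G β) _ = adjoint _ _
      rw [adjoint_pickOpTensor_tmul hβ.isMultiplier, ContinuousLinearMap.adjoint_comp,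
        ContinuousLinearMap.adjoint_comp, ContinuousLinearMap.comp_apply,
        ContinuousLinearMap.comp_apply, adjoint_tensorLid_apply, adjoint_tensorMap, tensorMap_tmul,
        hadj', ContinuousLinearMap.adjoint_id, ContinuousLinearMap.id_apply,
        hF.isMultiplier.adjoint_multOpTensor_tmul, ContinuousLinearMap.adjoint_comp, hadj,
        ContinuousLinearMap.comp_apply, hii, adjoint_pickRow_one]
    -- Naturality of the identification `U ⊗ X ≃ X` with respect to `J`.
    have h2 : tensorLid (H ⊗ₕ G) ∘L tensorMap i' (ContinuousLinearMap.id ℂ (H ⊗ₕ G)) ∘L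
        tensorMap (ContinuousLinearMap.id ℂ U) J =
        J ∘L tensorLid M ∘L tensorMap i' (ContinuousLinearMap.id ℂ M) :=
      continuousLinearMap_ext_tmul fun x y => by
        simp [tensorMap_tmul, tensorLid_tmul]
    calc pickOpTensor H G β ∘L tensorMap (ContinuousLinearMap.id ℂ B) J
        = tensorLid (H ⊗ₕ G) ∘L tensorMap i' (ContinuousLinearMap.id ℂ (H ⊗ₕ G)) ∘L
          (multOpTensor H G (fun l => i ∘L pickRow β l) ∘L
            tensorMap (ContinuousLinearMap.id ℂ B) J) := by rw [h1]; rfl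
      _ = (tensorLid (H ⊗ₕ G) ∘L tensorMap i' (ContinuousLinearMap.id ℂ (H ⊗ₕ G)) ∘L
          tensorMap (ContinuousLinearMap.id ℂ U) J) ∘L T := by rw [hTJ]; rfl
      _ = _ := by rw [h2]; rfl

/-- `ℂ`, as a Hilbert space in an arbitrary universe. -/
noncomputable def complexEquivEuclideanPUnit : ℂ ≃ₗᵢ[ℂ] EuclideanSpace ℂ PUnit.{u + 1} :=
  (OrthonormalBasis.singleton PUnit.{u + 1} ℂ).repr

end Main

end PickSpace

theorem mainTheorem1 {Λ : Type v} (K : Λ → Λ → ℂ) (hK : IsPickKernel K)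
    -- the reproducing kernel Hilbert space with kernel `K`
    (H : Type u) [NormedAddCommGroup H] [InnerProductSpace ℂ H] [CompleteSpace H]
    [RKHS ℂ H Λ ℂ] (hH : scalarKernel H = K)
    -- the base point, and the function `β` that determines the operator `𝐁`
    (l₀ : Λ) {B : Type u} [NormedAddCommGroup B] [InnerProductSpace ℂ B] [CompleteSpace B]
    (β : Λ → B) (hβ : IsPickRealization K l₀ β)
    (G : Type u) [NormedAddCommGroup G] [InnerProductSpace ℂ G] [CompleteSpace G]
    -- the contractively included subspace of `H ⊗ G`, with its inclusion map
    (M : Type w) [NormedAddCommGroup M] [InnerProductSpace ℂ M] [CompleteSpace M]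
    (J : M →L[ℂ] H ⊗ₕ G) (hJ : IsContractiveInclusion J) :
    List.TFAE [
      ∀ (E' E : Type u) [NormedAddCommGroup E'] [InnerProductSpace ℂ E'] [CompleteSpace E']
        [NormedAddCommGroup E] [InnerProductSpace ℂ E] [CompleteSpace E] (F : Λ → E' →L[ℂ] E),
        (IsMultiplier H F → MapsRange (multOpTensor H G F)
          (tensorMap (ContinuousLinearMap.id ℂ E') J)
          (tensorMap (ContinuousLinearMap.id ℂ E) J)) ∧
        (IsContractiveMultiplier H F → ContractiveOnRange (multOpTensor H G F)
          (tensorMap (ContinuousLinearMap.id ℂ E') J)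
          (tensorMap (ContinuousLinearMap.id ℂ E) J)),
      MapsRange (pickOpTensor H G β) (tensorMap (ContinuousLinearMap.id ℂ B) J) J ∧
        ContractiveOnRange (pickOpTensor H G β) (tensorMap (ContinuousLinearMap.id ℂ B) J) J,
      ∃ (G' : Type u) (_ : NormedAddCommGroup G') (_ : InnerProductSpace ℂ G')
        (_ : CompleteSpace G') (F : Λ → G' →L[ℂ] G), IsContractiveMultiplier H F ∧
          SameRangeSpace J (tensorComm G H ∘L multOp H F)] := by
  have hpick := isContractiveMultiplier_pickRow hK H hH l₀ β hβ
  have hJn : ‖J‖ ≤ 1 :=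
    J.opNorm_le_bound zero_le_one fun x => (hJ.2 x).trans_eq (one_mul _).symm
  tfae_have 1 → 2 := by
    intro h
    refine (mapsRange_and_contractiveOnRange_iff _ _ _).mpr
      (pickOpTensor_lift_of_linearIsometryEquiv complexEquivEuclideanPUnit.{u} hpick
        fun F hF => ?_)
    exact (mapsRange_and_contractiveOnRange_iff _ _ _).mp
      ⟨(h _ _ F).1 hF.isMultiplier, (h _ _ F).2 hF⟩
  tfae_have 2 → 3 := by
    intro h
    obtain ⟨T, hT, hTJ⟩ := (mapsRange_and_contractiveOnRange_iff _ _ _).mp h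
    obtain ⟨F, hF⟩ := exists_multiplier_of_pickOpTensor_lift hK hH l₀ hβ hJn hT hTJ
    -- The coefficient space is `H ⊗ G` because the square root of `D` takes its values there.
    exact ⟨H ⊗ₕ G, inferInstance, inferInstance, inferInstance, F, hF⟩
  tfae_have 3 → 1 := by
    rintro ⟨G', _, _, _, Φ, hΦ, hJΦ⟩ E' E _ _ _ _ _ _ F
    constructor
    · intro hF
      obtain ⟨T, -, hTJ⟩ := exists_lift_multOpTensor hΦ.isMultiplier hJΦ hF
      exact (mapsRange_contractiveOnRange_of_factor hTJ).1
    · intro hF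
      obtain ⟨T, hT, hTJ⟩ := exists_lift_multOpTensor hΦ.isMultiplier hJΦ hF.isMultiplier
      exact (mapsRange_contractiveOnRange_of_factor hTJ).2 (hT.trans hF.norm_multOpTensor_le)
  tfae_finish
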